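/- Let $\eta$ be a positive equivalence relation, that is, a recursively enumerable equivalence relation on $\mathbb N$ with infinitely many equivalence classes. Let $a_0<a_1<a_2<\cdots$ be the numbers that are least in their $\eta$-class, let $A_n=\{x:\exists m<n\;[x\,\eta\,a_m]\}$, and let $\mathcal A_\eta=\{A_n:n\in\mathbb N\}$ be the ascending family for $\eta$. An $\eta$-family is a class of sets, each a union of $\eta$-classes, that has a one-one uniformly r.e. numbering $B_0,B_1,\ldots$ A text for a set $L\subseteq\mathbb N$ is a map $T:\mathbb N\to\mathbb N\cup\{\#\}$ with $\operatorname{range}(T)\setminus\{\#\}=L$; $T[n]$ is the sequence $T(0),\ldots,T(n-1)$, and $\operatorname{cnt}(T[n])$ is the set of numbers that occur in it. A learner is a recursive function $M:(\mathbb N\cup\{\#\})^*\to\mathbb N\cup\{?\}$. A learner $M$ conservatively explanatorily learns a class $\mathcal C$ with respect to a hypothesis space $H_0,H_1,\ldots$ if for every $L\in\mathcal C$ and every text $T$ for $L$, 1. there is an $n$ with $M(T[n])\in\mathbb N$, $H_{M(T[n])}=L$ and $M(T[j])=M(T[n])$ for all $j\ge n$; and 2. for all $n\in\mathbb N$ and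 $k\ge 1$ with $M(T[n])\in\mathbb N$, if $M(T[n])\ne M(T[n+k])$ then $\operatorname{cnt}(T[n+k])\not\subseteq H_{M(T[n])}$. $\mathcal C$ is conservatively explanatorily learnable if some learner does this with respect to the standard numbering $W_0,W_1,\ldots$ of all r.e. sets. It is class-preservingly conservatively explanatorily learnable if some learner does this with respect to some uniformly r.e. hypothesis space $H_0,H_1,\ldots$ with $\{H_i:i\in\mathbb N\}=\mathcal C$. **Theorem.** For every positive equivalence relation $\eta$ there is an $\eta$-family $\mathcal C\subseteq\mathcal A_\eta$ that is conservatively explanatorily learnable but not class-preservingly conservatively explanatorily learnable. Moreover, $\mathcal C$ can be taken of the form $\{A_{f(n)+1}:n\in\mathbb N\}$, where $f:\mathbb N\to\mathbb N$ is strictly increasing, is the pointwise limit of a uniformly recursive approximation that is non-decreasing in the stage, and dominates every recursive function $g$ (that is, $g(n)\le f(n)$ for all but finitely many $n$). -/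

import Mathlib

namespace EtaLearn

/-- A positive equivalence relation on `ℕ`: recursively enumerable, with infinitely many
equivalence classes. -/
def IsPositive (η : Setoid ℕ) : Prop :=
  REPred (fun p : ℕ × ℕ => η p.1 p.2) ∧ Infinite (Quotient η)

/-- `a_n`: the `n`-th (in increasing order, starting with `n = 0`) number that is the least element
of its `η`-equivalence class. -/
noncomputable def leastRep (η : Setoid ℕ) (n : ℕ) : ℕ :=
  Nat.nth (fun x => ∀ y, η x y → x ≤ y) n

/-- `A_n = [a_0, …, a_{n-1}]`. -/
def ascendingSet (η : Setoid ℕ) (n : ℕ) : Set ℕ :=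
  {x | ∃ m < n, η x (leastRep η m)}

/-- The ascending family `{A_n : n ∈ ℕ}` of `η`. -/
def ascendingFamily (η : Setoid ℕ) : Set (Set ℕ) :=
  Set.range (ascendingSet η)

/-- The set `L` is a union of `η`-equivalence classes. -/
def IsEtaClosed (η : Setoid ℕ) (L : Set ℕ) : Prop :=
  ∀ x ∈ L, ∀ y, η x y → y ∈ L

/-- The numbering `H_0, H_1, …` of sets is uniformly recursively enumerable. -/
def UniformlyRE (H : ℕ → Set ℕ) : Prop :=
  REPred (fun p : ℕ × ℕ => p.2 ∈ H p.1)

/-- An `η`-family: a class of `η`-closed sets with a one-one uniformly r.e. numbering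
`B_0, B_1, …` (in particular, the class is infinite). -/
def IsEtaFamily (η : Setoid ℕ) (C : Set (Set ℕ)) : Prop :=
  (∀ L ∈ C, IsEtaClosed η L) ∧
    ∃ B : ℕ → Set ℕ, UniformlyRE B ∧ Function.Injective B ∧ Set.range B = C

/-- `W_e`: the domain of the `e`-th partial recursive function. -/
def W (e : ℕ) : Set ℕ :=
  {x | ((Denumerable.ofNat Nat.Partrec.Code e).eval x).Dom}

/-- `T` is a text for `L`; the pause symbol `#` is `none`. -/
def IsText (T : ℕ → Option ℕ) (L : Set ℕ) : Prop :=
  {x | ∃ i, T i = some x} = L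

/-- The initial segment `T[n] = T(0), …, T(n-1)`. -/
def initSeg (T : ℕ → Option ℕ) (n : ℕ) : List (Option ℕ) :=
  (List.range n).map T

/-- The content of a finite sequence: the numbers (not `#`) which occur in it. -/
def content (σ : List (Option ℕ)) : Set ℕ :=
  {x | some x ∈ σ}

/-- A learner, as a map from finite sequences to conjectures; the symbol `?` is `none`. Learners
are required to be computable wherever they are quantified over. -/
abbrev Learner := List (Option ℕ) → Option ℕ

/-- `M` explanatorily learns `C` with respect to the hypothesis space `H_0, H_1, …`. -/
def ExLearns (H : ℕ → Set ℕ) (M : Learner) (C : Set (Set ℕ)) : Prop :=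
  ∀ L ∈ C, ∀ T, IsText T L →
    ∃ n e, M (initSeg T n) = some e ∧ H e = L ∧
      ∀ j ≥ n, M (initSeg T j) = M (initSeg T n)

/-- On texts for members of `C`, the learner `M` gives up a conjecture `e` only if the set `H_e`
does not contain all the data seen so far. Replacing `?` is not a change of conjecture. -/
def IsConservative (H : ℕ → Set ℕ) (M : Learner) (C : Set (Set ℕ)) : Prop :=
  ∀ L ∈ C, ∀ T, IsText T L → ∀ n k e, 1 ≤ k → M (initSeg T n) = some e →
    M (initSeg T n) ≠ M (initSeg T (n + k)) → ¬ content (initSeg T (n + k)) ⊆ H e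

/-- `C` has a recursive conservative explanatory learner with respect to the hypothesis space
`H_0, H_1, …`. -/
def ConsExLearnableWrt (H : ℕ → Set ℕ) (C : Set (Set ℕ)) : Prop :=
  ∃ M : Learner, Computable M ∧ ExLearns H M C ∧ IsConservative H M C

/-- `C` is conservatively explanatorily learnable: the conjectures are indices in the numbering
`W_0, W_1, …` of all r.e. sets. -/
def ConsExLearnable (C : Set (Set ℕ)) : Prop :=
  ConsExLearnableWrt W C

/-- `C` is class-preservingly conservatively explanatorily learnable: this is possible with respect
to some uniformly r.e. hypothesis space that consists exactly of the members of `C`. -/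
def ClassPreservingConsExLearnable (C : Set (Set ℕ)) : Prop :=
  ∃ H : ℕ → Set ℕ, UniformlyRE H ∧ Set.range H = C ∧ ConsExLearnableWrt H C

/-- `f` is the pointwise limit of a recursive approximation from below. -/
def LimitFromBelow (f : ℕ → ℕ) : Prop :=
  ∃ F : ℕ → ℕ → ℕ, Computable₂ F ∧ (∀ n, Monotone (F n)) ∧
    ∀ n, ∃ s₀, ∀ s ≥ s₀, F n s = f n

/-- `f` dominates every recursive function: it is eventually at least as large. -/
def DominatesRecursive (f : ℕ → ℕ) : Prop :=
  ∀ g : ℕ → ℕ, Computable g → ∃ n₀, ∀ n ≥ n₀, g n ≤ f n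

end EtaLearn

/-! The sets `A_n` form a strictly increasing chain, and `C` is a subchain so sparse that its index
function `f` dominates all recursive functions.

Positive half: `A_k` is the closure of `{0, …, a_k - 1}`, and `a_k` is the least number missing from
it. The learner guesses a gap `b` and conjectures the closure of `{0, …, b - 1}`, frozen once `b` is
seen to be equivalent to a smaller number. A wrong conjecture can then be recognised from the data:
either `b` itself appears, or the conjecture is frozen, hence decidable, and some datum is missing
from it. This learns the whole ascending family (`consExLearnable_ascendingFamily`), hence `C`; the
conjectures need not be members of `C`.

Negative half (`not_classPreservingConsExLearnable`): if every conjecture is a member of the chain,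
a conservative learner must see data outside its conjecture before changing its mind. Searching for
successive mind changes produces computable data which escape the `n`-th member after `n + 1`
rounds. Since that member contains all numbers up to `f n`, the sum of these data bounds `f n`
strictly from above, against domination.

Approximability of `f` from below makes the subchain uniformly r.e.
(`uniformlyRE_ascendingSet_of_limitFromBelow`). -/

namespace EtaLearn

/-! ### Bounded quantifiers, stages and unbounded search -/

section Computability

variable {α β : Type*} [Primcodable α] [Primcodable β]

theorem primrecPred_exists_mem {l : α → List β} {p : α → β → Prop} (hl : Primrec l)
    (hp : PrimrecPred fun q : α × β => p q.1 q.2) : PrimrecPred fun a => ∃ b ∈ l a, p a b := by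
  have h : PrimrecRel fun (b : β) (a : α) => p a b := hp.comp (Primrec.pair Primrec.snd Primrec.fst)
  exact h.exists_mem_list.comp hl Primrec.id

theorem primrecPred_forall_mem {l : α → List β} {p : α → β → Prop} (hl : Primrec l)
    (hp : PrimrecPred fun q : α × β => p q.1 q.2) : PrimrecPred fun a => ∀ b ∈ l a, p a b := by
  have h : PrimrecRel fun (b : β) (a : α) => p a b := hp.comp (Primrec.pair Primrec.snd Primrec.fst)
  exact h.forall_mem_list.comp hl Primrec.id

theorem primrecPred_exists_lt {k : α → ℕ} {p : α → ℕ → Prop} (hk : Primrec k)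
    (hp : PrimrecPred fun q : α × ℕ => p q.1 q.2) : PrimrecPred fun a => ∃ n < k a, p a n :=
  (primrecPred_exists_mem (Primrec.list_range.comp hk) hp).of_eq fun a => by simp

theorem primrecPred_forall_lt {k : α → ℕ} {p : α → ℕ → Prop} (hk : Primrec k)
    (hp : PrimrecPred fun q : α × ℕ => p q.1 q.2) : PrimrecPred fun a => ∀ n < k a, p a n :=
  (primrecPred_forall_mem (Primrec.list_range.comp hk) hp).of_eq fun a => by simp

/-- An r.e. predicate is the union of an increasing primitive recursive sequence of predicates. -/
theorem exists_stages {p : α → Prop} (hp : REPred p) :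
    ∃ Q : ℕ → α → Prop, PrimrecPred (fun q : ℕ × α => Q q.1 q.2) ∧
      (∀ s t a, s ≤ t → Q s a → Q t a) ∧ ∀ a, p a ↔ ∃ s, Q s a := by
  obtain ⟨c, hc⟩ := Nat.Partrec.Code.exists_code.1 hp
  refine ⟨fun s a => (Nat.Partrec.Code.evaln s c (Encodable.encode a)).isSome = true, ?_, ?_, ?_⟩
  · have h : Primrec fun q : ℕ × α =>
        (Nat.Partrec.Code.evaln q.1 c (Encodable.encode q.2)).isSome :=
      Primrec.option_isSome.comp (Nat.Partrec.Code.primrec_evaln.comp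
        (Primrec.pair (Primrec.pair Primrec.fst (Primrec.const c))
          (Primrec.encode.comp Primrec.snd)))
    exact Primrec.eq.comp h (Primrec.const true)
  · intro s t a hst h
    obtain ⟨v, hv⟩ := Option.isSome_iff_exists.1 h
    exact Option.isSome_iff_exists.2 ⟨v, Nat.Partrec.Code.evaln_mono hst hv⟩
  · intro a
    have h : (Nat.Partrec.Code.eval c (Encodable.encode a)).Dom ↔ p a := by
      rw [hc]
      simp [Part.assert, Part.bind, Part.some]
    rw [← h, Part.dom_iff_mem]
    simp only [Nat.Partrec.Code.evaln_complete, Option.isSome_iff_exists]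
    exact exists_comm

theorem rePred_exists {p : α → ℕ → Prop} (hp : ComputablePred fun q : α × ℕ => p q.1 q.2) :
    REPred fun a => ∃ n, p a n := by
  classical
  have h : Partrec fun a => Nat.rfind fun n => Part.some (decide (p a n)) :=
    Partrec.rfind hp.decide.partrec
  exact h.dom_re.of_eq fun a => Nat.rfind_dom.trans (by simp)

theorem computablePred_decode {p : α → β → Prop}
    (hp : ComputablePred fun q : α × β => p q.1 q.2) :
    ComputablePred fun q : α × ℕ => ∃ b ∈ Encodable.decode (α := β) q.2, p q.1 b := by
  classical
  have h : Computable fun q : α × ℕ =>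
      Option.casesOn (motive := fun _ => Bool) (Encodable.decode (α := β) q.2) false
        fun b => decide (p q.1 b) :=
    Computable.option_casesOn (Computable.decode.comp Computable.snd) (Computable.const false)
      (hp.decide.comp (Computable.pair (Computable.fst.comp Computable.fst) Computable.snd)).to₂
  refine ⟨Classical.decPred _, h.of_eq fun q => ?_⟩
  rcases hq : Encodable.decode (α := β) q.2 with _ | b <;> simp [hq]

theorem rePred_exists_encodable {p : α → β → Prop}
    (hp : ComputablePred fun q : α × β => p q.1 q.2) : REPred fun a => ∃ b, p a b := by
  have h' := computablePred_decode hp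
  refine (rePred_exists (p := fun a n => ∃ b ∈ Encodable.decode (α := β) n, p a b) h').of_eq
    fun a => ⟨fun ⟨_, b, _, hb⟩ => ⟨b, hb⟩, fun ⟨b, hb⟩ => ⟨Encodable.encode b, b, by simp, hb⟩⟩

/-- A total computable relation has a computable choice function. -/
theorem exists_computable_choice [Inhabited β] {p : α → β → Prop}
    (hp : ComputablePred fun q : α × β => p q.1 q.2) (htot : ∀ a, ∃ b, p a b) :
    ∃ g : α → β, Computable g ∧ ∀ a, p a (g a) := by
  classical
  have h' := computablePred_decode hp
  have ht : ∀ a, ∃ n, ∃ b ∈ Encodable.decode (α := β) n, p a b := fun a => by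
    obtain ⟨b, hb⟩ := htot a
    exact ⟨Encodable.encode b, b, by simp, hb⟩
  refine ⟨fun a => (Encodable.decode (α := β) (Nat.find (ht a))).getD default,
    Computable.option_getD (Computable.decode.comp
      (Computable.find (P := fun a n => ∃ b ∈ Encodable.decode (α := β) n, p a b) h' ht))
      (Computable.const _), fun a => ?_⟩
  obtain ⟨b, hb, hp⟩ := Nat.find_spec (ht a)
  simpa [Option.mem_def.1 hb] using hp

theorem primrec_sum_range {k : α → ℕ} {g : α → ℕ → ℕ} (hk : Primrec k) (hg : Primrec₂ g) :
    Primrec fun a => ∑ i ∈ Finset.range (k a), g a i := by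
  have h : Primrec₂ fun (a : α) (q : ℕ × ℕ) => q.2 + g a q.1 :=
    (Primrec.nat_add.comp (Primrec.snd.comp Primrec.snd)
      (hg.comp Primrec.fst (Primrec.fst.comp Primrec.snd))).to₂
  refine (Primrec.nat_rec' hk (Primrec.const 0) h).of_eq fun a => ?_
  induction k a with
  | zero => rfl
  | succ n ih => rw [Finset.sum_range_succ, ← ih]

end Computability

/-! ### Leaders of classes and the sets `A_n` -/

/-- `x` is the least element of its `η`-class. -/
def IsLeader (η : Setoid ℕ) (x : ℕ) : Prop := ∀ y, η x y → x ≤ y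

theorem leastRep_eq_nth (η : Setoid ℕ) (n : ℕ) : leastRep η n = Nat.nth (IsLeader η) n := rfl

theorem exists_isLeader (η : Setoid ℕ) (x : ℕ) : ∃ y ≤ x, η x y ∧ IsLeader η y := by
  classical
  have h : ∃ y, η x y := ⟨x, η.refl x⟩
  exact ⟨Nat.find h, Nat.find_min' h (η.refl x), Nat.find_spec h,
    fun z hz => Nat.find_min' h (η.trans (Nat.find_spec h) hz)⟩

theorem IsLeader.eq {η : Setoid ℕ} {x y : ℕ} (hx : IsLeader η x) (hy : IsLeader η y)
    (h : η x y) : x = y :=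
  le_antisymm (hx y h) (hy x (η.symm h))

theorem isLeader_iff_forall_lt {η : Setoid ℕ} {x : ℕ} : IsLeader η x ↔ ∀ z < x, ¬ η x z :=
  ⟨fun h z hz hxz => absurd (h z hxz) (not_le.2 hz), fun h z hxz => not_lt.1 fun hz => h z hz hxz⟩

theorem infinite_setOf_isLeader {η : Setoid ℕ} (hη : Infinite (Quotient η)) :
    (Set.ofPred (IsLeader η)).Infinite := by
  intro hfin
  have : Finite (Set.ofPred (IsLeader η)) := hfin
  refine not_finite_iff_infinite.2 hη (Finite.of_surjective
    (fun y : Set.ofPred (IsLeader η) => (Quotient.mk η y.1)) fun q => ?_)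
  induction q using Quotient.inductionOn with
  | h x =>
    obtain ⟨y, -, hxy, hy⟩ := exists_isLeader η x
    exact ⟨⟨y, hy⟩, Quotient.sound (η.symm hxy)⟩

theorem isEtaClosed_ascendingSet (η : Setoid ℕ) (n : ℕ) : IsEtaClosed η (ascendingSet η n) :=
  fun _ ⟨m, hm, hx⟩ _ hxy => ⟨m, hm, η.trans (η.symm hxy) hx⟩

theorem ascendingSet_mono (η : Setoid ℕ) : Monotone (ascendingSet η) :=
  fun _ _ hkl _ ⟨m, hm, hx⟩ => ⟨m, hm.trans_le hkl, hx⟩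

open Classical in
theorem mem_ascendingSet_iff {η : Setoid ℕ} (hη : Infinite (Quotient η)) {n x : ℕ} :
    x ∈ ascendingSet η n ↔ ∃ y, η x y ∧ IsLeader η y ∧ Nat.count (IsLeader η) y < n := by
  have hinf := infinite_setOf_isLeader hη
  constructor
  · rintro ⟨m, hm, hx⟩
    refine ⟨_, hx, Nat.nth_mem_of_infinite hinf m, ?_⟩
    rwa [leastRep_eq_nth, Nat.count_nth_of_infinite hinf]
  · rintro ⟨y, hxy, hy, hn⟩
    refine ⟨_, hn, ?_⟩
    rwa [leastRep_eq_nth, Nat.nth_count hy]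

/-- The leader `y` of the class of `x` has at most `y ≤ x` leaders below it, so `x ≤ n` would put
`x` into `A_(n+1)`. -/
theorem lt_of_notMem_ascendingSet {η : Setoid ℕ} (hη : Infinite (Quotient η)) {n x : ℕ}
    (h : x ∉ ascendingSet η (n + 1)) : n < x := by
  classical
  by_contra! hx
  obtain ⟨y, hyx, hxy, hy⟩ := exists_isLeader η x
  refine h ((mem_ascendingSet_iff hη).2 ⟨y, hxy, hy, ?_⟩)
  have := Nat.count_le (p := IsLeader η) (n := y)
  omega

theorem leastRep_mem_ascendingSet_iff {η : Setoid ℕ} (hη : Infinite (Quotient η)) {m n : ℕ} :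
    leastRep η m ∈ ascendingSet η n ↔ m < n := by
  have hinf := infinite_setOf_isLeader hη
  refine ⟨?_, fun h => ⟨m, h, η.refl _⟩⟩
  rintro ⟨k, hk, h⟩
  have := Nat.nth_injective hinf
    ((Nat.nth_mem_of_infinite hinf m : IsLeader η _).eq (Nat.nth_mem_of_infinite hinf k) h)
  omega

theorem ascendingSet_injective {η : Setoid ℕ} (hη : Infinite (Quotient η)) :
    Function.Injective (ascendingSet η) := by
  intro m n h
  by_contra hne
  rcases lt_or_gt_of_ne hne with hlt | hlt
  · exact lt_irrefl m ((leastRep_mem_ascendingSet_iff hη).1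
      (h ▸ (leastRep_mem_ascendingSet_iff hη).2 hlt))
  · exact lt_irrefl n ((leastRep_mem_ascendingSet_iff hη).1
      (h ▸ (leastRep_mem_ascendingSet_iff hη).2 hlt))

/-- This form, the closure of an initial segment of `ℕ`, is the one the learner's conjectures
imitate. -/
theorem mem_ascendingSet_iff_lt_leastRep {η : Setoid ℕ} (hη : Infinite (Quotient η)) {n x : ℕ} :
    x ∈ ascendingSet η n ↔ ∃ y < leastRep η n, η x y := by
  classical
  have hinf := infinite_setOf_isLeader hη
  constructor
  · rintro ⟨m, hm, hx⟩
    exact ⟨_, Nat.nth_strictMono hinf hm, hx⟩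
  · rintro ⟨y, hy, hxy⟩
    obtain ⟨z, hzy, hyz, hz⟩ := exists_isLeader η y
    refine (mem_ascendingSet_iff hη).2 ⟨z, η.trans hxy hyz, hz, ?_⟩
    have h := Nat.count_strict_mono hz (hzy.trans_lt hy)
    rwa [leastRep_eq_nth, Nat.count_nth_of_infinite hinf] at h

/-! ### Enumerating the sets `A_n` in stages -/

/-- `Q` is a primitive recursive enumeration of `η` in stages. -/
structure IsEnumeration (η : Setoid ℕ) (Q : ℕ → ℕ × ℕ → Prop) : Prop where
  primrec : PrimrecPred fun q : ℕ × (ℕ × ℕ) => Q q.1 q.2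
  mono : ∀ s t a, s ≤ t → Q s a → Q t a
  iff : ∀ x y, η x y ↔ ∃ s, Q s (x, y)

theorem exists_isEnumeration {η : Setoid ℕ} (hη : REPred fun p : ℕ × ℕ => η p.1 p.2) :
    ∃ Q, IsEnumeration η Q := by
  obtain ⟨Q, h₁, h₂, h₃⟩ := exists_stages hη
  exact ⟨Q, h₁, h₂, fun x y => h₃ (x, y)⟩

/-- At stage `s` of the enumeration `Q`, no number below `x` is known to be equivalent to `x`. -/
def StageLeader (Q : ℕ → ℕ × ℕ → Prop) (s x : ℕ) : Prop := ∀ z < x, ¬ Q s (x, z)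

namespace IsEnumeration

variable {η : Setoid ℕ} {Q : ℕ → ℕ × ℕ → Prop}

theorem primrec_stageLeader (hQ : IsEnumeration η Q) :
    PrimrecPred fun q : ℕ × ℕ => StageLeader Q q.1 q.2 :=
  primrecPred_forall_lt Primrec.snd (hQ.primrec.comp (Primrec.pair (Primrec.fst.comp Primrec.fst)
    (Primrec.pair (Primrec.snd.comp Primrec.fst) Primrec.snd))).not

theorem stageLeader_of_isLeader (hQ : IsEnumeration η Q) {x : ℕ} (hx : IsLeader η x) (s : ℕ) :
    StageLeader Q s x :=
  fun z hz h => isLeader_iff_forall_lt.1 hx z hz ((hQ.iff x z).2 ⟨s, h⟩)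

theorem stageLeader_anti (hQ : IsEnumeration η Q) {s t x : ℕ} (hst : s ≤ t)
    (h : StageLeader Q t x) : StageLeader Q s x :=
  fun z hz hq => h z hz (hQ.mono s t _ hst hq)

theorem exists_not_stageLeader (hQ : IsEnumeration η Q) {x : ℕ} (hx : ¬ IsLeader η x) :
    ∃ s, ¬ StageLeader Q s x := by
  rw [isLeader_iff_forall_lt] at hx
  push Not at hx
  obtain ⟨z, hz, h⟩ := hx
  obtain ⟨s, hs⟩ := (hQ.iff x z).1 h
  exact ⟨s, fun h => h z hz hs⟩

open Classical in
theorem primrec_count_stageLeader (hQ : IsEnumeration η Q) :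
    Primrec₂ fun s n => Nat.count (StageLeader Q s) n := by
  have h : Primrec fun q : ℕ × ℕ => ∑ i ∈ Finset.range q.2, if StageLeader Q q.1 i then 1 else 0 :=
    primrec_sum_range Primrec.snd (Primrec.ite (hQ.primrec_stageLeader.comp
      (Primrec.pair (Primrec.fst.comp Primrec.fst) Primrec.snd)) (Primrec.const 1)
      (Primrec.const 0)).to₂
  refine h.of_eq fun q => ?_
  exact (Nat.count_eq_card_filter_range _ _).trans (Finset.card_filter _ _) |>.symm

open Classical in
/-- Every sufficiently late stage counts the leaders below a bound correctly. -/
theorem exists_count_stageLeader_eq (hQ : IsEnumeration η Q) (n : ℕ) :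
    ∃ s₀, ∀ s ≥ s₀, Nat.count (StageLeader Q s) n = Nat.count (IsLeader η) n := by
  induction n with
  | zero => exact ⟨0, by simp⟩
  | succ n ih =>
    obtain ⟨s₀, hs₀⟩ := ih
    by_cases hn : IsLeader η n
    · refine ⟨s₀, fun s hs => ?_⟩
      rw [Nat.count_succ, Nat.count_succ, hs₀ s hs, if_pos hn,
        if_pos (hQ.stageLeader_of_isLeader hn s)]
    · obtain ⟨s₁, hs₁⟩ := hQ.exists_not_stageLeader hn
      refine ⟨max s₀ s₁, fun s hs => ?_⟩
      rw [Nat.count_succ, Nat.count_succ, hs₀ s (le_of_max_le_left hs), if_neg hn,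
        if_neg fun h => hs₁ (hQ.stageLeader_anti (le_of_max_le_right hs) h)]

-- Stage counts never underestimate the number of leaders up to `y`, so a small count at any stage
-- certifies membership; late stages count exactly, so every member is found.
open Classical in
theorem mem_ascendingSet_iff_exists_stage (hQ : IsEnumeration η Q) (hη : Infinite (Quotient η))
    {n x : ℕ} : x ∈ ascendingSet η n ↔
      ∃ s y, Q s (x, y) ∧ Nat.count (StageLeader Q s) (y + 1) ≤ n := by
  rw [mem_ascendingSet_iff hη]
  constructor
  · rintro ⟨y, hxy, hy, hn⟩
    obtain ⟨s₀, hs₀⟩ := hQ.exists_count_stageLeader_eq (y + 1)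
    obtain ⟨s₁, hs₁⟩ := (hQ.iff x y).1 hxy
    refine ⟨max s₀ s₁, y, hQ.mono _ _ _ (le_max_right _ _) hs₁, ?_⟩
    rw [hs₀ _ (le_max_left _ _), Nat.count_succ, if_pos hy]
    exact hn
  · rintro ⟨s, y, hxy, hn⟩
    obtain ⟨z, hzy, hyz, hz⟩ := exists_isLeader η y
    refine ⟨z, η.trans ((hQ.iff x y).2 ⟨s, hxy⟩) hyz, hz, ?_⟩
    have h₁ : Nat.count (IsLeader η) (z + 1) ≤ Nat.count (IsLeader η) (y + 1) :=
      Nat.count_monotone _ (by omega)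
    have h₂ : Nat.count (IsLeader η) (y + 1) ≤ Nat.count (StageLeader Q s) (y + 1) :=
      Nat.count_mono_left fun k _ hk => hQ.stageLeader_of_isLeader hk s
    rw [Nat.count_succ, if_pos hz] at h₁
    omega

end IsEnumeration

/-- The approximations never exceed `f n`, so enumerating with an early value as index adds nothing
wrong; a late value gives everything. -/
theorem uniformlyRE_ascendingSet_of_limitFromBelow {η : Setoid ℕ} (hη : IsPositive η) {f : ℕ → ℕ}
    (hf : LimitFromBelow f) : UniformlyRE fun n => ascendingSet η (f n + 1) := by
  classical
  obtain ⟨Q, hQ⟩ := exists_isEnumeration hη.1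
  obtain ⟨F, hF, hmono, hlim⟩ := hf
  have hle : ∀ n s, F n s ≤ f n := fun n s => by
    obtain ⟨s₀, hs₀⟩ := hlim n
    rw [← hs₀ (max s s₀) (le_max_right _ _)]
    exact hmono n (le_max_left _ _)
  have hcomp : ComputablePred fun q : (ℕ × ℕ) × (ℕ × ℕ × ℕ) =>
      Q q.2.1 (q.1.2, q.2.2.1) ∧
        Nat.count (StageLeader Q q.2.1) (q.2.2.1 + 1) ≤ F q.1.1 q.2.2.2 + 1 := by
    have h : PrimrecPred fun r : ((ℕ × ℕ) × (ℕ × ℕ × ℕ)) × ℕ =>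
        Q r.1.2.1 (r.1.1.2, r.1.2.2.1) ∧
          Nat.count (StageLeader Q r.1.2.1) (r.1.2.2.1 + 1) ≤ r.2 + 1 := by
      have hs : Primrec fun r : ((ℕ × ℕ) × (ℕ × ℕ × ℕ)) × ℕ => r.1.2.1 :=
        Primrec.fst.comp (Primrec.snd.comp Primrec.fst)
      have hx : Primrec fun r : ((ℕ × ℕ) × (ℕ × ℕ × ℕ)) × ℕ => r.1.1.2 :=
        Primrec.snd.comp (Primrec.fst.comp Primrec.fst)
      have hy : Primrec fun r : ((ℕ × ℕ) × (ℕ × ℕ × ℕ)) × ℕ => r.1.2.2.1 :=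
        Primrec.fst.comp (Primrec.snd.comp (Primrec.snd.comp Primrec.fst))
      exact (hQ.primrec.comp (Primrec.pair hs (Primrec.pair hx hy))).and
        (Primrec.nat_le.comp (hQ.primrec_count_stageLeader.comp hs (Primrec.succ.comp hy))
          (Primrec.succ.comp Primrec.snd))
    refine ⟨Classical.decPred _, (h.decide.to_comp.comp (Computable.pair Computable.id
      (hF.comp (Computable.fst.comp Computable.fst)
        (Computable.snd.comp (Computable.snd.comp Computable.snd))))).of_eq fun q => ?_⟩
    exact decide_eq_decide.2 Iff.rfl
  refine (rePred_exists_encodable (p := fun (a : ℕ × ℕ) (b : ℕ × ℕ × ℕ) =>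
    Q b.1 (a.2, b.2.1) ∧ Nat.count (StageLeader Q b.1) (b.2.1 + 1) ≤ F a.1 b.2.2 + 1)
    hcomp).of_eq fun a => ?_
  rw [hQ.mem_ascendingSet_iff_exists_stage hη.2]
  constructor
  · rintro ⟨⟨s, y, t⟩, h, hn⟩
    exact ⟨s, y, h, hn.trans (Nat.succ_le_succ (hle _ _))⟩
  · rintro ⟨s, y, h, hn⟩
    obtain ⟨s₀, hs₀⟩ := hlim a.1
    exact ⟨⟨s, y, s₀⟩, h, by simpa [hs₀ s₀ le_rfl] using hn⟩

/-! ### A dominating function approximable from below -/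

open Nat.Partrec (Code)

/-- `n` plus the values at `p.2` of the programs `p.1` that halt within `s` steps, where `p`
ranges over a finite set of pairs that contains all `(e, n)` with `e ≤ n`. -/
def dominatingApprox (n s : ℕ) : ℕ :=
  n + ∑ p ∈ Finset.range ((n + 1) ^ 2),
    ((Code.evaln s (Denumerable.ofNat Code p.unpair.1) p.unpair.2).getD 0)

theorem primrec_dominatingApprox : Primrec₂ dominatingApprox := by
  refine (Primrec.nat_add.comp Primrec.fst (primrec_sum_range (α := ℕ × ℕ)
    (k := fun q => (q.1 + 1) ^ 2) (g := fun q p => (Code.evaln q.2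
      (Denumerable.ofNat Code p.unpair.1) p.unpair.2).getD 0) ?_ ?_)).to₂
  · have h : Primrec fun q : ℕ × ℕ => q.1 + 1 := Primrec.succ.comp Primrec.fst
    exact (Primrec.nat_mul.comp h h).of_eq fun q => (sq _).symm
  · exact (Primrec.option_getD.comp (Code.primrec_evaln.comp (Primrec.pair
      (Primrec.pair (Primrec.snd.comp Primrec.fst)
        ((Primrec.ofNat Code).comp (Primrec.fst.comp (Primrec.unpair.comp Primrec.snd))))
      (Primrec.snd.comp (Primrec.unpair.comp Primrec.snd)))) (Primrec.const 0)).to₂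

theorem evaln_getD_mono (c : Code) (n : ℕ) : Monotone fun s => (Code.evaln s c n).getD 0 := by
  intro s t hst
  rcases h : Code.evaln s c n with _ | v
  · simp [h]
  · have := Code.evaln_mono hst h
    rw [Option.mem_def] at this
    simp [h, this]

theorem dominatingApprox_mono (n : ℕ) : Monotone (dominatingApprox n) := fun _ _ hst =>
  Nat.add_le_add_left (Finset.sum_le_sum fun _ _ => evaln_getD_mono _ _ hst) n

theorem dominatingApprox_strictMono (s : ℕ) : StrictMono fun n => dominatingApprox n s := by
  intro m n hmn
  refine Nat.add_lt_add_of_lt_of_le hmn (Finset.sum_le_sum_of_subset ?_)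
  exact Finset.range_subset_range.2 (Nat.pow_le_pow_left (by omega) 2)

theorem exists_evaln_getD_eq (c : Code) (n : ℕ) :
    ∃ v, ∀ᶠ s in Filter.atTop, (Code.evaln s c n).getD 0 = v := by
  by_cases h : ∃ s v, v ∈ Code.evaln s c n
  · obtain ⟨s, v, hv⟩ := h
    refine ⟨v, Filter.eventually_atTop.2 ⟨s, fun t ht => ?_⟩⟩
    rw [Option.mem_def.1 (Code.evaln_mono ht hv), Option.getD_some]
  · push Not at h
    refine ⟨0, Filter.Eventually.of_forall fun s => ?_⟩
    rw [Option.eq_none_iff_forall_not_mem.2 (h s), Option.getD_none]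

theorem exists_limit_dominatingApprox (n : ℕ) :
    ∃ v, ∀ᶠ s in Filter.atTop, dominatingApprox n s = v := by
  choose v hv using fun p : ℕ =>
    exists_evaln_getD_eq (Denumerable.ofNat Code p.unpair.1) p.unpair.2
  refine ⟨n + ∑ p ∈ Finset.range ((n + 1) ^ 2), v p, ?_⟩
  filter_upwards [(Finset.eventually_all (Finset.range ((n + 1) ^ 2))).2 fun p _ => hv p] with s hs
  rw [dominatingApprox, Finset.sum_congr rfl hs]

theorem exists_strictMono_limitFromBelow_dominatesRecursive :
    ∃ f : ℕ → ℕ, StrictMono f ∧ LimitFromBelow f ∧ DominatesRecursive f := by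
  choose f hf using exists_limit_dominatingApprox
  refine ⟨f, fun m n hmn => ?_, ⟨dominatingApprox, primrec_dominatingApprox.to_comp,
    dominatingApprox_mono, fun n => Filter.eventually_atTop.1 (hf n)⟩, fun g hg => ?_⟩
  · obtain ⟨s, hm, hn⟩ := ((hf m).and (hf n)).exists
    rw [← hm, ← hn]
    exact dominatingApprox_strictMono s hmn
  · obtain ⟨c, hc⟩ := Code.exists_code.1 (Partrec.nat_iff.1 hg.partrec)
    refine ⟨Encodable.encode c, fun n hn => ?_⟩
    have hmem : g n ∈ c.eval n := by rw [hc]; simp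
    obtain ⟨s, hs⟩ := Code.evaln_complete.1 hmem
    obtain ⟨t, ht, hst⟩ := ((hf n).and (Filter.eventually_ge_atTop s)).exists
    have ht' := Option.mem_def.1 (Code.evaln_mono hst hs)
    -- Once `n` is at least the index of `g`, the value `g n` is one of the summands of `f n`.
    have hp : Nat.pair (Encodable.encode c) n ∈ Finset.range ((n + 1) ^ 2) := by
      have := Nat.pair_lt_max_add_one_sq (Encodable.encode c) n
      rwa [max_eq_right hn, ← Finset.mem_range] at this
    have := Finset.single_le_sum (f := fun p =>
      (Code.evaln t (Denumerable.ofNat Code p.unpair.1) p.unpair.2).getD 0)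
      (fun _ _ => Nat.zero_le _) hp
    simp only [Nat.unpair_pair, Denumerable.ofNat_encode, ht', Option.getD_some] at this
    rw [← ht]
    exact this.trans (Nat.le_add_left _ _)

/-! ### Texts, finite data and their extensions -/

theorem content_append (σ τ : List (Option ℕ)) : content (σ ++ τ) = content σ ∪ content τ := by
  ext x
  simp [content]

theorem length_initSeg (T : ℕ → Option ℕ) (n : ℕ) : (initSeg T n).length = n := by
  simp [initSeg]

theorem initSeg_succ (T : ℕ → Option ℕ) (n : ℕ) : initSeg T (n + 1) = initSeg T n ++ [T n] := by
  simp [initSeg, List.range_succ]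

theorem initSeg_add (T : ℕ → Option ℕ) (n k : ℕ) :
    ∃ v, v.length = k ∧ initSeg T (n + k) = initSeg T n ++ v := by
  induction k with
  | zero => exact ⟨[], rfl, by simp⟩
  | succ k ih =>
    obtain ⟨v, hv, h⟩ := ih
    exact ⟨v ++ [T (n + k)], by simp [hv], by rw [← add_assoc, initSeg_succ, h, List.append_assoc]⟩

theorem content_initSeg_mono (T : ℕ → Option ℕ) : Monotone fun n => content (initSeg T n) := by
  intro m n hmn
  obtain ⟨k, rfl⟩ := Nat.exists_eq_add_of_le hmn
  obtain ⟨v, -, h⟩ := initSeg_add T m k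
  simp only [h, content_append]
  exact Set.subset_union_left

theorem some_mem_initSeg {T : ℕ → Option ℕ} {n x : ℕ} :
    some x ∈ initSeg T n ↔ ∃ i < n, T i = some x := by
  simp [initSeg]

theorem IsText.content_initSeg_subset {T : ℕ → Option ℕ} {L : Set ℕ} (hT : IsText T L) (n : ℕ) :
    content (initSeg T n) ⊆ L := by
  intro x hx
  obtain ⟨i, -, hi⟩ := some_mem_initSeg.1 hx
  exact hT ▸ ⟨i, hi⟩

theorem IsText.exists_mem_content {T : ℕ → Option ℕ} {L : Set ℕ} (hT : IsText T L) {x : ℕ}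
    (hx : x ∈ L) : ∃ n₀, ∀ n ≥ n₀, x ∈ content (initSeg T n) := by
  rw [← hT] at hx
  obtain ⟨i, hi⟩ := hx
  exact ⟨i + 1, fun n hn => some_mem_initSeg.2 ⟨i, by omega, hi⟩⟩

theorem exists_isText_extending {σ : List (Option ℕ)} {L : Set ℕ} (hσ : content σ ⊆ L) :
    ∃ T, IsText T L ∧ initSeg T σ.length = σ := by
  classical
  -- After `σ`, position `σ.length + x` shows `x` if `x ∈ L` and a pause otherwise.
  refine ⟨fun i => (σ[i]?).getD (if i - σ.length ∈ L then some (i - σ.length) else none), ?_, ?_⟩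
  · ext x
    simp only [Set.mem_ofPred_eq]
    constructor
    · rintro ⟨i, hi⟩
      by_cases h : i < σ.length
      · rw [List.getElem?_eq_getElem h, Option.getD_some] at hi
        exact hσ (hi ▸ List.getElem_mem h : some x ∈ σ)
      · rw [List.getElem?_eq_none (not_lt.1 h), Option.getD_none] at hi
        split_ifs at hi with hm
        exact Option.some.inj hi ▸ hm
    · intro hx
      refine ⟨σ.length + x, ?_⟩
      rw [List.getElem?_eq_none (Nat.le_add_right _ _), Option.getD_none, Nat.add_sub_cancel_left,
        if_pos hx]
  · refine List.ext_getElem (length_initSeg _ _) fun i h₁ h₂ => ?_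
    simp [initSeg, h₂]

theorem content_subset_of_monotone {B : ℕ → Set ℕ} (hB : Monotone B) (hcov : ∀ x, ∃ n, x ∈ B n)
    (σ : List (Option ℕ)) : ∃ n, content σ ⊆ B n := by
  induction σ with
  | nil => exact ⟨0, fun x hx => by simp [content] at hx⟩
  | cons o σ ih =>
    obtain ⟨n, hn⟩ := ih
    obtain ⟨m, hm⟩ : ∃ m, ∀ x, o = some x → x ∈ B m := by
      cases o with
      | none => exact ⟨0, by simp⟩
      | some y =>
        obtain ⟨m, hm⟩ := hcov y
        exact ⟨m, fun x hx => Option.some.inj hx ▸ hm⟩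
    refine ⟨max n m, fun x hx => ?_⟩
    rcases List.mem_cons.1 hx with h | h
    · exact hB (le_max_right _ _) (hm x h.symm)
    · exact hB (le_max_left _ _) (hn h)

/-- The sum of the numbers that occur in a finite sequence. -/
def contentSum (σ : List (Option ℕ)) : ℕ := σ.foldr (fun o m => o.getD 0 + m) 0

theorem le_contentSum {σ : List (Option ℕ)} {x : ℕ} (hx : x ∈ content σ) : x ≤ contentSum σ := by
  induction σ with
  | nil => simp [content] at hx
  | cons o σ ih =>
    change x ≤ o.getD 0 + contentSum σ
    rcases List.mem_cons.1 hx with h | h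
    · simp [← h]
    · exact (ih h).trans (Nat.le_add_left _ _)

theorem primrec_contentSum : Primrec contentSum :=
  Primrec.list_foldr Primrec.id (Primrec.const 0) (Primrec.nat_add.comp
    (Primrec.option_getD.comp (Primrec.fst.comp Primrec.snd) (Primrec.const 0))
    (Primrec.snd.comp Primrec.snd)).to₂

/-- Run the learner on a text for `L` that begins with `σ`, until it has converged. -/
theorem ExLearns.exists_extension {H : ℕ → Set ℕ} {M : Learner} {C : Set (Set ℕ)}
    (hM : ExLearns H M C) {L : Set ℕ} (hL : L ∈ C) {σ : List (Option ℕ)} (hσ : content σ ⊆ L) :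
    ∃ u e, M (σ ++ u) = some e ∧ H e = L ∧ content (σ ++ u) ⊆ L := by
  obtain ⟨T, hT, hTσ⟩ := exists_isText_extending hσ
  obtain ⟨n, e, he, hHe, hconv⟩ := hM L hL T hT
  obtain ⟨u, -, hu⟩ := initSeg_add T σ.length n
  rw [hTσ] at hu
  refine ⟨u, e, ?_, hHe, ?_⟩
  · rw [← hu, hconv _ (Nat.le_add_left _ _), he]
  · rw [← hu]
    exact hT.content_initSeg_subset _

theorem IsConservative.not_content_subset {H : ℕ → Set ℕ} {M : Learner} {C : Set (Set ℕ)}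
    (hM : IsConservative H M C) {L : Set ℕ} (hL : L ∈ C) {σ v : List (Option ℕ)} {e : ℕ}
    (hσ : content (σ ++ v) ⊆ L) (he : M σ = some e) (hne : M (σ ++ v) ≠ some e) :
    ¬ content (σ ++ v) ⊆ H e := by
  obtain ⟨T, hT, hTσ⟩ := exists_isText_extending hσ
  have hpre : initSeg T σ.length = σ := by
    obtain ⟨w, -, hw⟩ := initSeg_add T σ.length v.length
    rw [← List.length_append, hTσ] at hw
    exact (List.append_inj_left hw (length_initSeg _ _).symm).symm
  have hv : 1 ≤ v.length := by
    rw [Nat.one_le_iff_ne_zero]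
    intro h
    rw [List.length_eq_zero_iff.1 h, List.append_nil] at hne
    exact hne he
  have := hM L hL T hT σ.length v.length e hv (by rw [hpre, he])
    (by rw [hpre, ← List.length_append, hTσ, he]; exact fun h => hne h.symm)
  rwa [← List.length_append, hTσ] at this

/-! ### No class-preserving conservative learner for a sparse chain -/

/-- A strictly increasing chain of sets, the `n`-th of which contains all numbers up to `f n` for a
function `f` that dominates all recursive functions, has no class-preserving conservative
learner: from such a learner one computes a function that is larger than `f` everywhere. -/
theorem not_classPreservingConsExLearnable {B : ℕ → Set ℕ} {f : ℕ → ℕ} (hB : StrictMono B)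
    (hf : DominatesRecursive f) (hfB : ∀ n x, x ∉ B n → f n < x) :
    ¬ ClassPreservingConsExLearnable (Set.range B) := by
  classical
  rintro ⟨H, hH, hHB, M, hMcomp, hMex, hMcons⟩
  have hcov : ∀ x, ∃ n, x ∈ B n := fun x => by
    obtain ⟨n₀, hn₀⟩ := hf id Computable.id
    refine ⟨max n₀ x, by_contra fun h => ?_⟩
    have h₁ := hfB _ _ h
    have h₂ := hn₀ (max n₀ x) (le_max_left _ _)
    simp only [id] at h₂
    omega
  obtain ⟨Q, hQprim, hQmono, hQ⟩ := exists_stages hH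
  -- The witness is `(u, v, s, e)`: after `σ ++ u` the conjecture is `e`, the data so far are
  -- verified to lie in `H e` by stage `s`, and appending `v` changes the conjecture.
  let Step : List (Option ℕ) → List (Option ℕ) × List (Option ℕ) × ℕ × ℕ → Prop := fun σ b =>
    (M (σ ++ b.1) = some b.2.2.2 ∧ M (σ ++ b.1 ++ b.2.1) ≠ some b.2.2.2) ∧
      ∀ o ∈ σ ++ b.1, ∀ x ∈ o.toList, Q b.2.2.1 (b.2.2.2, x)
  have hcomp : ComputablePred fun q : List (Option ℕ) × List (Option ℕ) × List (Option ℕ) × ℕ × ℕ =>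
      Step q.1 q.2 := by
    have hτ : Computable fun q : List (Option ℕ) × List (Option ℕ) × List (Option ℕ) × ℕ × ℕ =>
        q.1 ++ q.2.1 :=
      Computable.list_append.comp Computable.fst (Computable.fst.comp Computable.snd)
    have he : Computable fun q : List (Option ℕ) × List (Option ℕ) × List (Option ℕ) × ℕ × ℕ =>
        q.2.2.2.2 :=
      Computable.snd.comp (Computable.snd.comp (Computable.snd.comp Computable.snd))
    have h₁ := (Primrec.eq (α := Option ℕ)).decide.to_comp.comp (hMcomp.comp hτ)
      (Computable.option_some.comp he)
    have h₂ := (Primrec.eq (α := Option ℕ)).decide.to_comp.comp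
      (hMcomp.comp (Computable.list_append.comp hτ
        (Computable.fst.comp (Computable.snd.comp Computable.snd))))
      (Computable.option_some.comp he)
    have h₃ : PrimrecPred fun r : List (Option ℕ) × ℕ × ℕ =>
        ∀ o ∈ r.1, ∀ x ∈ o.toList, Q r.2.1 (r.2.2, x) :=
      primrecPred_forall_mem Primrec.fst (primrecPred_forall_mem
        (Primrec.optionToList.comp Primrec.snd) (hQprim.comp (Primrec.pair
          (Primrec.fst.comp (Primrec.snd.comp (Primrec.fst.comp Primrec.fst)))
          (Primrec.pair (Primrec.snd.comp (Primrec.snd.comp (Primrec.fst.comp Primrec.fst)))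
            Primrec.snd))))
    have h₃' := h₃.decide.to_comp.comp (Computable.pair hτ
      (Computable.snd.comp (Computable.snd.comp Computable.snd)))
    refine ⟨Classical.decPred _, (Primrec.and.to_comp.comp (Primrec.and.to_comp.comp h₁
      (Primrec.not.to_comp.comp h₂)) h₃').of_eq fun q => ?_⟩
    simp [Step]
  -- Lead the learner to `B n`, then onwards to `B (n + 1)`. The two sets differ, so it must change
  -- its mind.
  have hstep : ∀ σ, ∃ b, Step σ b := fun σ => by
    obtain ⟨n, hn⟩ := content_subset_of_monotone hB.monotone hcov σ
    obtain ⟨u, e, he, hHe, hu⟩ := hMex.exists_extension ⟨n, rfl⟩ hn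
    obtain ⟨v, e', he', hHe', -⟩ := hMex.exists_extension ⟨n + 1, rfl⟩
      (hu.trans (hB.monotone n.le_succ))
    have hs : ∀ τ : List (Option ℕ), content τ ⊆ H e →
        ∃ s, ∀ o ∈ τ, ∀ x ∈ o.toList, Q s (e, x) := by
      intro τ hτ
      -- Adding the complement of `H e` makes the stages cover `ℕ`, as the lemma demands; it is
      -- removed again below because the data lie in `H e`.
      obtain ⟨s, hs⟩ := content_subset_of_monotone (B := fun s => {x | Q s (e, x)} ∪ {x | x ∉ H e})
        (fun s t hst x hx => hx.imp (hQmono s t _ hst) id) (fun x => by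
          by_cases hx : x ∈ H e
          · obtain ⟨s, hs⟩ := (hQ (e, x)).1 hx
            exact ⟨s, Or.inl hs⟩
          · exact ⟨0, Or.inr hx⟩) τ
      refine ⟨s, fun o ho x hx => ?_⟩
      have hx' : x ∈ content τ := by
        rw [Option.mem_toList] at hx
        subst hx
        exact ho
      exact (hs hx').resolve_right fun h => h (hτ hx')
    obtain ⟨s, hs⟩ := hs (σ ++ u) (hHe ▸ hu)
    refine ⟨(u, v, s, e), ⟨he, ?_⟩, hs⟩
    rw [he']
    intro h
    rw [Option.some.inj h, hHe] at hHe'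
    exact absurd (hB.injective hHe') (by omega)
  obtain ⟨g, hg, hgs⟩ := exists_computable_choice hcomp hstep
  let seq : ℕ → List (Option ℕ) := fun n =>
    Nat.rec [] (fun _ σ => σ ++ (g σ).1 ++ (g σ).2.1) n
  have hseq : Computable seq := by
    have hlast : Computable fun q : ℕ × ℕ × List (Option ℕ) => q.2.2 :=
      Computable.snd.comp Computable.snd
    exact Computable.nat_rec Computable.id (Computable.const [])
      (Computable.list_append.comp (Computable.list_append.comp hlast
        (Computable.fst.comp (hg.comp hlast)))
        (Computable.fst.comp (Computable.snd.comp (hg.comp hlast)))).to₂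
  -- Class preservation enters here: the abandoned conjecture is some `B k`, and conservativeness
  -- gives a datum outside it, hence outside every `B j` with `j ≤ k`. If `k < j`, then `k < i`, and
  -- by induction `seq i` already escapes `B k`, although it was verified to lie in it.
  have hesc : ∀ i, ∀ j < i, ∃ x ∈ content (seq i), x ∉ B j := by
    intro i
    induction i with
    | zero => intro j hj; omega
    | succ i ih =>
      intro j hj
      have hsucc : seq (i + 1) = seq i ++ (g (seq i)).1 ++ (g (seq i)).2.1 := rfl
      obtain ⟨⟨he, hne⟩, hcont⟩ := hgs (seq i)
      obtain ⟨k, hk⟩ : H (g (seq i)).2.2.2 ∈ Set.range B := hHB ▸ Set.mem_range_self _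
      have hsub : content (seq i ++ (g (seq i)).1) ⊆ B k := fun x hx => by
        rw [hk]
        exact (hQ (_, x)).2 ⟨_, hcont (some x) hx x (by simp)⟩
      -- Conservativeness is only required on texts for members of the class, so the data must fit
      -- inside one.
      obtain ⟨m, hm⟩ := content_subset_of_monotone hB.monotone hcov (seq (i + 1))
      have hnot := hMcons.not_content_subset ⟨m, rfl⟩ hm he hne
      rw [← hk, Set.not_subset] at hnot
      obtain ⟨x, hx, hxk⟩ := hnot
      refine ⟨x, hx, fun hxj => ?_⟩
      rcases le_or_gt j k with hjk | hkj
      · exact hxk (hB.monotone hjk hxj)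
      · obtain ⟨y, hy, hyk⟩ := ih k (by omega)
        exact hyk (hsub (by rw [content_append]; exact Or.inl hy))
  obtain ⟨n₀, hn₀⟩ := hf (fun n => contentSum (seq (n + 1)))
    (primrec_contentSum.to_comp.comp (hseq.comp Computable.succ))
  obtain ⟨x, hx, hxB⟩ := hesc (n₀ + 1) n₀ (by omega)
  have h₁ := hfB _ _ hxB
  have h₂ := hn₀ n₀ le_rfl
  have h₃ := le_contentSum hx
  omega

/-! ### The conservative learner for the ascending family -/

/-- `x` is put into the hypothesis `b` at stage `t`: it is known to be equivalent to a number below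
`b`, while `b` is not. -/
def StageMem (Q : ℕ → ℕ × ℕ → Prop) (t b x : ℕ) : Prop :=
  (∃ y < b, Q t (x, y)) ∧ StageLeader Q t b

/-- The closure of `{0, …, b - 1}` under equivalence, enumerated only until `b` is found to be
equivalent to a smaller number. -/
def hypothesis (Q : ℕ → ℕ × ℕ → Prop) (b : ℕ) : Set ℕ := {x | ∃ t, StageMem Q t b x}

theorem notMem_hypothesis (Q : ℕ → ℕ × ℕ → Prop) (b : ℕ) : b ∉ hypothesis Q b :=
  fun ⟨_, ⟨y, hy, h⟩, hl⟩ => hl y hy h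

/-- The data `σ` are known to refute the hypothesis `b`. -/
def Refutes (Q : ℕ → ℕ × ℕ → Prop) (σ : List (Option ℕ)) (b : ℕ) : Prop :=
  (∃ o ∈ σ, o = some b) ∨ ¬ StageLeader Q σ.length b ∧
    ∃ o ∈ σ, ∃ x ∈ o.toList, ∀ t < σ.length, ¬ StageMem Q t b x

/-- The least number up to the length of `σ` which does not occur in `σ`. -/
def firstGap (σ : List (Option ℕ)) : ℕ :=
  (List.range (σ.length + 1)).findIdx fun n => decide (∀ o ∈ σ, o ≠ some n)

open Classical in
/-- The learner keeps its hypothesis until it is refuted, and then moves to the first gap in the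
data. The state consists of the hypothesis and the data seen so far. -/
noncomputable def gapState (Q : ℕ → ℕ × ℕ → Prop) (σ : List (Option ℕ)) :
    ℕ × List (Option ℕ) :=
  σ.foldl (fun p o => (if Refutes Q (p.2 ++ [o]) p.1 then firstGap (p.2 ++ [o]) else p.1,
    p.2 ++ [o])) (0, [])

theorem gapState_snd (Q : ℕ → ℕ × ℕ → Prop) (σ : List (Option ℕ)) : (gapState Q σ).2 = σ := by
  induction σ using List.reverseRecOn with
  | nil => rfl
  | append_singleton σ o ih =>
    rw [gapState, List.foldl_append]
    change (gapState Q σ).2 ++ [o] = σ ++ [o]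
    rw [ih]

open Classical in
theorem gapState_append_fst (Q : ℕ → ℕ × ℕ → Prop) (σ : List (Option ℕ)) (o : Option ℕ) :
    (gapState Q (σ ++ [o])).1 =
      if Refutes Q (σ ++ [o]) (gapState Q σ).1 then firstGap (σ ++ [o])
      else (gapState Q σ).1 := by
  conv_lhs => rw [gapState, List.foldl_append]
  change (if Refutes Q ((gapState Q σ).2 ++ [o]) (gapState Q σ).1 then
    firstGap ((gapState Q σ).2 ++ [o]) else (gapState Q σ).1) = _
  rw [gapState_snd]

theorem mem_content_of_lt_firstGap {σ : List (Option ℕ)} {n : ℕ} (hn : n < firstGap σ) :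
    n ∈ content σ := by
  have h := List.not_of_lt_findIdx hn
  simpa [content] using h

theorem firstGap_eq {σ : List (Option ℕ)} {b : ℕ} (hb : b ∉ content σ)
    (hlt : ∀ n < b, n ∈ content σ) (hlen : b ≤ σ.length) : firstGap σ = b := by
  rw [firstGap, List.findIdx_eq (by simpa using Nat.lt_succ_of_le hlen)]
  constructor
  · simp only [List.getElem_range, decide_eq_true_eq]
    exact fun o ho h => hb (h ▸ ho : some b ∈ σ)
  · intro j hj
    have := hlt j hj
    simpa [content] using this

theorem primrec_firstGap : Primrec firstGap := by
  refine Primrec.list_findIdx (Primrec.list_range.comp (Primrec.succ.comp Primrec.list_length)) ?_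
  exact (primrecPred_forall_mem (p := fun (q : List (Option ℕ) × ℕ) o => o ≠ some q.2) Primrec.fst
    (Primrec.eq.comp Primrec.snd
      (Primrec.option_some.comp (Primrec.snd.comp Primrec.fst))).not).decide

namespace IsEnumeration

variable {η : Setoid ℕ} {Q : ℕ → ℕ × ℕ → Prop}

theorem primrec_stageMem (hQ : IsEnumeration η Q) :
    PrimrecPred fun q : ℕ × ℕ × ℕ => StageMem Q q.1 q.2.1 q.2.2 := by
  refine (primrecPred_exists_lt (Primrec.fst.comp Primrec.snd) (hQ.primrec.comp (Primrec.pair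
    (Primrec.fst.comp Primrec.fst) (Primrec.pair
      (Primrec.snd.comp (Primrec.snd.comp Primrec.fst)) Primrec.snd)))).and ?_
  exact hQ.primrec_stageLeader.comp (Primrec.pair Primrec.fst (Primrec.fst.comp Primrec.snd))

theorem primrec_refutes (hQ : IsEnumeration η Q) :
    PrimrecPred fun q : List (Option ℕ) × ℕ => Refutes Q q.1 q.2 := by
  have hlen : Primrec fun q : List (Option ℕ) × ℕ => q.1.length :=
    Primrec.list_length.comp Primrec.fst
  refine (primrecPred_exists_mem Primrec.fst (Primrec.eq.comp Primrec.snd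
    (Primrec.option_some.comp (Primrec.snd.comp Primrec.fst)))).or
    ((hQ.primrec_stageLeader.comp (Primrec.pair hlen Primrec.snd)).not.and
      (primrecPred_exists_mem Primrec.fst (primrecPred_exists_mem
        (Primrec.optionToList.comp Primrec.snd) (primrecPred_forall_lt
          (hlen.comp (Primrec.fst.comp Primrec.fst)) (hQ.primrec_stageMem.comp
            (Primrec.pair Primrec.snd (Primrec.pair
              (Primrec.snd.comp (Primrec.fst.comp (Primrec.fst.comp Primrec.fst)))
              (Primrec.snd.comp Primrec.fst)))).not))))

theorem primrec_gapState (hQ : IsEnumeration η Q) : Primrec (gapState Q) := by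
  classical
  have hb : Primrec fun r : List (Option ℕ) × (ℕ × List (Option ℕ)) × Option ℕ => r.2.1.1 :=
    Primrec.fst.comp (Primrec.fst.comp Primrec.snd)
  have hτ : Primrec fun r : List (Option ℕ) × (ℕ × List (Option ℕ)) × Option ℕ =>
      r.2.1.2 ++ [r.2.2] :=
    Primrec.list_concat.comp (Primrec.snd.comp (Primrec.fst.comp Primrec.snd))
      (Primrec.snd.comp Primrec.snd)
  exact Primrec.list_foldl Primrec.id (Primrec.const (0, []))
    (Primrec.pair (Primrec.ite (hQ.primrec_refutes.comp (Primrec.pair hτ hb))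
      (primrec_firstGap.comp hτ) hb) hτ).to₂

/-- If `b` has lost its stage leadership by stage `σ.length`, nothing enters the hypothesis from
then on, so a datum absent at all earlier stages is absent forever. -/
theorem not_subset_of_refutes (hQ : IsEnumeration η Q) {σ : List (Option ℕ)} {b : ℕ}
    (h : Refutes Q σ b) : ¬ content σ ⊆ hypothesis Q b := by
  intro hsub
  rcases h with ⟨o, ho, rfl⟩ | ⟨hl, o, ho, x, hx, hn⟩
  · exact notMem_hypothesis Q b (hsub ho)
  · rw [Option.mem_toList] at hx
    subst hx
    obtain ⟨t, ht⟩ := hsub ho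
    refine hn t ?_ ht
    by_contra! hlt
    exact hl (hQ.stageLeader_anti hlt ht.2)

theorem hypothesis_eq (hQ : IsEnumeration η Q) {b : ℕ} (hb : IsLeader η b) :
    hypothesis Q b = {x | ∃ y < b, η x y} := by
  ext x
  constructor
  · rintro ⟨t, ⟨y, hy, h⟩, -⟩
    exact ⟨y, hy, (hQ.iff x y).2 ⟨t, h⟩⟩
  · rintro ⟨y, hy, h⟩
    obtain ⟨t, ht⟩ := (hQ.iff x y).1 h
    exact ⟨t, ⟨y, hy, ht⟩, hQ.stageLeader_of_isLeader hb t⟩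

theorem hypothesis_subset (hQ : IsEnumeration η Q) {b : ℕ} {L : Set ℕ} (hL : IsEtaClosed η L)
    (hb : ∀ n < b, n ∈ L) : hypothesis Q b ⊆ L :=
  fun x ⟨t, ⟨y, hy, h⟩, _⟩ => hL y (hb y hy) x (η.symm ((hQ.iff x y).2 ⟨t, h⟩))

end IsEnumeration

/-- This invariant prevents overgeneralisation: with `hypothesis_subset`, the conjecture stays
inside every `η`-closed set that contains the data. -/
theorem mem_content_of_lt_gapState (Q : ℕ → ℕ × ℕ → Prop) (σ : List (Option ℕ)) :
    ∀ n < (gapState Q σ).1, n ∈ content σ := by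
  induction σ using List.reverseRecOn with
  | nil => intro n hn; exact absurd hn (Nat.not_lt_zero n)
  | append_singleton σ o ih =>
    intro n hn
    rw [gapState_append_fst] at hn
    split_ifs at hn
    · exact mem_content_of_lt_firstGap hn
    · rw [content_append]
      exact Or.inl (ih n hn)

/-- The first departure from the conjecture comes from a refutation, and later data only add to the
content. -/
theorem IsEnumeration.gapState_conservative {η : Setoid ℕ} {Q : ℕ → ℕ × ℕ → Prop}
    (hQ : IsEnumeration η Q) (T : ℕ → Option ℕ) (n k : ℕ)
    (h : (gapState Q (initSeg T n)).1 ≠ (gapState Q (initSeg T (n + k))).1) :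
    ¬ content (initSeg T (n + k)) ⊆ hypothesis Q (gapState Q (initSeg T n)).1 := by
  induction k with
  | zero => exact absurd rfl h
  | succ k ih =>
    by_cases hk : (gapState Q (initSeg T n)).1 = (gapState Q (initSeg T (n + k))).1
    · rw [← add_assoc, initSeg_succ, gapState_append_fst, ← hk] at h
      split_ifs at h with hr
      · rw [← add_assoc, initSeg_succ]
        exact hQ.not_subset_of_refutes hr
      · exact absurd rfl h
    · exact fun hsub => ih hk ((content_initSeg_mono T (by omega)).trans hsub)

theorem IsEnumeration.gapState_converges {η : Setoid ℕ} {Q : ℕ → ℕ × ℕ → Prop}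
    (hQ : IsEnumeration η Q) (hη : Infinite (Quotient η)) {k : ℕ} {T : ℕ → Option ℕ}
    (hT : IsText T (ascendingSet η k)) :
    ∃ n, hypothesis Q (gapState Q (initSeg T n)).1 = ascendingSet η k ∧
      ∀ j ≥ n, (gapState Q (initSeg T j)).1 = (gapState Q (initSeg T n)).1 := by
  set a := leastRep η k with ha
  have hal : IsLeader η a := Nat.nth_mem_of_infinite (infinite_setOf_isLeader hη) k
  have haE : hypothesis Q a = ascendingSet η k := by
    rw [hQ.hypothesis_eq hal]
    ext x
    exact (mem_ascendingSet_iff_lt_leastRep hη).symm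
  have ha' : a ∉ ascendingSet η k := fun h =>
    lt_irrefl k ((leastRep_mem_ascendingSet_iff hη).1 h)
  have hanot : ∀ n, ¬ Refutes Q (initSeg T n) a := fun n hr =>
    hQ.not_subset_of_refutes hr (haE ▸ hT.content_initSeg_subset n)
  obtain ⟨n₀, hn₀⟩ : ∃ n₀, ∀ n ≥ n₀, firstGap (initSeg T n) = a := by
    have h : ∀ z : ℕ, ∃ n₀, z < a → ∀ n ≥ n₀, z ∈ content (initSeg T n) := fun z => by
      by_cases hz : z < a
      · obtain ⟨n₀, h⟩ := hT.exists_mem_content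
          ((mem_ascendingSet_iff_lt_leastRep hη).2 ⟨z, hz, η.refl z⟩)
        exact ⟨n₀, fun _ => h⟩
      · exact ⟨0, fun h => absurd h hz⟩
    choose N hN using h
    -- By then all numbers below `a` have appeared; length at least `a` keeps `a` within the range
    -- searched by `firstGap`.
    refine ⟨max a ((Finset.range a).sup N), fun n hn => firstGap_eq
      (fun h => ha' (hT.content_initSeg_subset n h)) (fun z hz => hN z hz n ?_) ?_⟩
    · exact (Finset.le_sup (Finset.mem_range.2 hz)).trans ((le_max_right _ _).trans hn)
    · rw [length_initSeg]
      exact (le_max_left _ _).trans hn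
  -- A late refutation moves the learner to `a`, which is correct and never refuted. Without one,
  -- the final conjecture `b` has to be shown correct.
  by_cases hr : ∃ n ≥ n₀, Refutes Q (initSeg T (n + 1)) (gapState Q (initSeg T n)).1
  · obtain ⟨n, hn, hr⟩ := hr
    have hconv : ∀ j ≥ n + 1, (gapState Q (initSeg T j)).1 = a := by
      intro j hj
      induction j, hj using Nat.le_induction with
      | base =>
        rw [initSeg_succ] at hr ⊢
        rw [gapState_append_fst, if_pos hr, ← initSeg_succ]
        exact hn₀ _ (by omega)
      | succ j hj ih =>
        have := hanot (j + 1)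
        rw [initSeg_succ] at this ⊢
        rw [gapState_append_fst, ih, if_neg this]
    exact ⟨n + 1, by rw [hconv _ le_rfl, haE], fun j hj => by rw [hconv j hj, hconv _ le_rfl]⟩
  · push Not at hr
    have hconv : ∀ j ≥ n₀, (gapState Q (initSeg T j)).1 = (gapState Q (initSeg T n₀)).1 := by
      intro j hj
      induction j, hj using Nat.le_induction with
      | base => rfl
      | succ j hj ih =>
        have := hr j hj
        rw [initSeg_succ] at this ⊢
        rw [gapState_append_fst, if_neg this, ih]
    refine ⟨n₀, ?_, hconv⟩
    set b := (gapState Q (initSeg T n₀)).1 with hb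
    have hnot : ∀ n ≥ n₀, ¬ Refutes Q (initSeg T (n + 1)) b := fun n hn =>
      hconv n hn ▸ hr n hn
    refine Set.Subset.antisymm (hQ.hypothesis_subset (isEtaClosed_ascendingSet η k) fun n hn =>
      hT.content_initSeg_subset n₀ (mem_content_of_lt_gapState Q _ n hn)) fun x hx => ?_
    -- If `b` is a leader, it cannot lie in the target, as its appearance would refute it; hence `a
    -- ≤ b`. If not, its hypothesis freezes, and any element it misses would eventually refute it.
    by_cases hbl : IsLeader η b
    · have hbL : b ∉ ascendingSet η k := fun hbL => by
        obtain ⟨m, hm⟩ := hT.exists_mem_content hbL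
        exact hnot (max n₀ m) (le_max_left _ _)
          (Or.inl ⟨_, hm _ ((le_max_right _ _).trans (Nat.le_succ _)), rfl⟩)
      have hab : a ≤ b := not_lt.1 fun h =>
        hbL ((mem_ascendingSet_iff_lt_leastRep hη).2 ⟨b, h, η.refl b⟩)
      obtain ⟨y, hy, hxy⟩ := (mem_ascendingSet_iff_lt_leastRep hη).1 hx
      rw [hQ.hypothesis_eq hbl]
      exact ⟨y, hy.trans_le hab, hxy⟩
    · obtain ⟨s, hs⟩ := hQ.exists_not_stageLeader hbl
      obtain ⟨m, hm⟩ := hT.exists_mem_content hx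
      have hn := hnot (max n₀ (max s m)) (le_max_left _ _)
      by_contra hxE
      refine hn (Or.inr ⟨fun h => hs (hQ.stageLeader_anti ?_ h), some x, hm _ ?_, x, by simp,
        fun t _ h => hxE ⟨t, h⟩⟩)
      · rw [length_initSeg]
        omega
      · omega

/-! ### Passing to the standard numbering -/

/-- A uniformly r.e. hypothesis space can be translated computably into indices in
the standard numbering. -/
theorem UniformlyRE.exists_index {H : ℕ → Set ℕ} (hH : UniformlyRE H) :
    ∃ t : ℕ → ℕ, Computable t ∧ ∀ i, W (t i) = H i := by
  have h : Nat.Partrec fun n => (Part.assert (n.unpair.2 ∈ H n.unpair.1)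
      fun _ => Part.some ()).map fun _ => 0 :=
    Partrec.nat_iff.1 ((Partrec.comp hH Computable.unpair).map (Computable.const 0).to₂)
  obtain ⟨c, hc⟩ := Nat.Partrec.Code.exists_code.1 h
  refine ⟨fun i => Encodable.encode (c.curry i), Computable.encode.comp
    (Nat.Partrec.Code.primrec₂_curry.to_comp.comp (Computable.const c) Computable.id),
    fun i => ?_⟩
  ext x
  change ((Denumerable.ofNat Nat.Partrec.Code (Encodable.encode (c.curry i))).eval x).Dom ↔ _
  rw [Denumerable.ofNat_encode, Nat.Partrec.Code.eval_curry, hc]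
  simp [Part.assert, Part.some, Part.map]

/-- The translation need not be injective: a change of the translated index still forces a change of
the original one. -/
theorem UniformlyRE.consExLearnable {H : ℕ → Set ℕ} (hH : UniformlyRE H) {C : Set (Set ℕ)}
    (hC : ConsExLearnableWrt H C) : ConsExLearnable C := by
  obtain ⟨t, ht, hW⟩ := hH.exists_index
  obtain ⟨M, hM, hex, hcons⟩ := hC
  refine ⟨fun σ => (M σ).map t, Computable.option_map hM (ht.comp Computable.snd).to₂,
    fun L hL T hT => ?_, fun L hL T hT n k e hk he hne => ?_⟩
  · obtain ⟨n, e, he, hHe, hconv⟩ := hex L hL T hT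
    exact ⟨n, t e, congrArg (Option.map t) he, by rw [hW, hHe],
      fun j hj => congrArg (Option.map t) (hconv j hj)⟩
  · obtain ⟨i, hi, rfl⟩ := Option.map_eq_some_iff.1 he
    rw [hW]
    exact hcons L hL T hT n k i hk hi fun h => hne (congrArg (Option.map t) h)

/-- The ascending family of a positive equivalence relation is conservatively learnable. -/
theorem consExLearnable_ascendingFamily {η : Setoid ℕ} (hη : IsPositive η) :
    ConsExLearnable (ascendingFamily η) := by
  obtain ⟨Q, hQ⟩ := exists_isEnumeration hη.1
  have hH : UniformlyRE (hypothesis Q) := rePred_exists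
    (p := fun (a : ℕ × ℕ) t => StageMem Q t a.1 a.2)
    (hQ.primrec_stageMem.comp (Primrec.pair Primrec.snd Primrec.fst)).computablePred
  refine hH.consExLearnable ⟨fun σ => some (gapState Q σ).1,
    Computable.option_some.comp (Computable.fst.comp hQ.primrec_gapState.to_comp), ?_, ?_⟩
  · rintro _ ⟨k, rfl⟩ T hT
    obtain ⟨n, hn, hconv⟩ := hQ.gapState_converges hη.2 hT
    exact ⟨n, _, rfl, hn, fun j hj => congrArg some (hconv j hj)⟩
  · rintro _ - T - n k e - he hne
    obtain rfl := Option.some.inj he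
    exact hQ.gapState_conservative T n k fun h => hne (congrArg some h)

theorem ConsExLearnable.mono {C D : Set (Set ℕ)} (hCD : C ⊆ D) (hD : ConsExLearnable D) :
    ConsExLearnable C := by
  obtain ⟨M, hM, hex, hcons⟩ := hD
  exact ⟨M, hM, fun L hL => hex L (hCD hL), fun L hL => hcons L (hCD hL)⟩

end EtaLearn

theorem theorem7p3 (η : Setoid ℕ) (hη : EtaLearn.IsPositive η) :
    ∃ f : ℕ → ℕ, StrictMono f ∧ EtaLearn.LimitFromBelow f ∧ EtaLearn.DominatesRecursive f ∧
      ∃ C : Set (Set ℕ), C = Set.range (fun n => EtaLearn.ascendingSet η (f n + 1)) ∧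
        C ⊆ EtaLearn.ascendingFamily η ∧ EtaLearn.IsEtaFamily η C ∧
        EtaLearn.ConsExLearnable C ∧ ¬ EtaLearn.ClassPreservingConsExLearnable C := by
  obtain ⟨f, hf, hlim, hdom⟩ := EtaLearn.exists_strictMono_limitFromBelow_dominatesRecursive
  have hmono : StrictMono fun n => EtaLearn.ascendingSet η (f n + 1) :=
    ((EtaLearn.ascendingSet_mono η).strictMono_of_injective
      (EtaLearn.ascendingSet_injective hη.2)).comp fun _ _ h => Nat.succ_lt_succ (hf h)
  have hsub : Set.range (fun n => EtaLearn.ascendingSet η (f n + 1)) ⊆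
      EtaLearn.ascendingFamily η := Set.range_subset_iff.2 fun n => Set.mem_range_self _
  refine ⟨f, hf, hlim, hdom, _, rfl, hsub, ⟨?_, _,
    EtaLearn.uniformlyRE_ascendingSet_of_limitFromBelow hη hlim, hmono.injective, rfl⟩,
    (EtaLearn.consExLearnable_ascendingFamily hη).mono hsub,
    EtaLearn.not_classPreservingConsExLearnable hmono hdom fun n x hx =>
      EtaLearn.lt_of_notMem_ascendingSet hη.2 hx⟩
  rintro _ ⟨n, rfl⟩
  exact EtaLearn.isEtaClosed_ascendingSet η _
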